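/- Let $p$ be a prime number and let $V$ be a normal complex variety (for instance, a factorial Fano variety with terminal singularities). Let $U^+\subset V$ be a non-empty open subset whose complement has codimension at least $2$, and let $\sigma^+\colon U_X^+\to U^+$ be a cyclic cover of order $p$, that is, a finite dominant morphism from a normal (for instance, non-singular) variety $U_X^+$ such that ${\mathbb C}(U^+)\subset{\mathbb C}(U_X^+)$ is a Galois extension with cyclic Galois group of order $p$. Let $W^+\subset U^+$ be its branch locus (the image of the set of points at which $\sigma^+$ is ramified) and $\overline{W^+}$ the closure of $W^+$ in $V$. Let $X$ be a variety over $V$ that is birational over $V$ to $U_X^+$. Let ${\cal L}$ be an invertible sheaf on $V$ (for instance, ${\cal O}_V(N)$), let $a_0,a_1\in H^0(V,{\cal L})$ be sections such that no prime divisor of $V$ is contained in the zero sets of both, and let $$X_0=\{a_1x_1^p-a_0x_0^p=0\}\subset V\times{\mathbb P}^1_{(x_0:x_1)}.$$ Assume that $X$ is birational over $V$ to $X_0$ (which is considered over $V$ by means of the projection to the first factor). Then for every prime divisor $T$ on $V$ on which $a_0$ or $a_1$ vanishes the number $$\mu(T)=\max\{\mathrm{ord}_T\,a_0,\ \mathrm{ord}_T\,a_1\}$$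 is finite, and $T\subset\overline{W^+}$ if and only if $p$ does not divide $\mu(T)$. -/

import Mathlib

open CategoryTheory AlgebraicGeometry

noncomputable section

namespace CyclicCover

/-! ### Ideal sheaves of locally principal closed subschemes -/

lemma exists_pow_mul_mem {X : Scheme.{0}} (I : ∀ x : X, Ideal (X.presheaf.stalk x))
    (hI : ∀ x : X, ∃ (O : X.Opens) (_ : x ∈ O) (q : Γ(X, O)),
      ∀ (y : X) (hy : y ∈ O), I y = Ideal.span {X.presheaf.germ O y hy q})
    (Z : X.affineOpens) (h f : Γ(X, Z))
    (hf : ∀ (y : X) (hy : y ∈ X.basicOpen h),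
      X.presheaf.germ Z y (X.basicOpen_le h hy) f ∈ I y) :
    ∃ m : ℕ, ∀ (y : X) (hy : y ∈ Z.1), X.presheaf.germ Z y hy (h ^ m * f) ∈ I y := by
  suffices H : ∃ m : ℕ, ∀ (y : X) (_ : y ∈ (Z.1 : Set X)) (hy : y ∈ Z.1),
      X.presheaf.germ Z y hy (h ^ m * f) ∈ I y by
    obtain ⟨m, hm⟩ := H
    exact ⟨m, fun y hy ↦ hm y hy hy⟩
  refine Z.2.isCompact.induction_on (p := fun S ↦ ∃ m : ℕ, ∀ (y : X) (_ : y ∈ S) (hy : y ∈ Z.1),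
      X.presheaf.germ Z y hy (h ^ m * f) ∈ I y) ⟨0, by simp⟩ ?_ ?_ ?_
  · rintro s t hst ⟨m, hm⟩
    exact ⟨m, fun y hy ↦ hm y (hst hy)⟩
  · rintro s t ⟨m, hm⟩ ⟨n, hn⟩
    refine ⟨m + n, fun y hy hyZ ↦ ?_⟩
    rcases hy with hy | hy
    · have := Ideal.mul_mem_left _ (X.presheaf.germ Z y hyZ (h ^ n)) (hm y hy hyZ)
      rw [← map_mul] at this
      convert this using 2
      ring
    · have := Ideal.mul_mem_left _ (X.presheaf.germ Z y hyZ (h ^ m)) (hn y hy hyZ)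
      rw [← map_mul] at this
      convert this using 2
      ring
  · intro z hz
    obtain ⟨O, hzO, q, hq⟩ := hI z
    obtain ⟨_, ⟨A, hA, rfl⟩, hzA, hAU⟩ := X.isBasis_affineOpens.exists_subset_of_mem_open
      (show z ∈ ((Z.1 ⊓ O : X.Opens) : Set X) from ⟨hz, hzO⟩) (Z.1 ⊓ O).2
    have hAZ : A ≤ Z.1 := fun x hx ↦ (hAU hx).1
    have hAO : A ≤ O := fun x hx ↦ (hAU hx).2
    set h' : Γ(X, A) := X.presheaf.map (homOfLE hAZ).op h with hh'
    set f' : Γ(X, A) := X.presheaf.map (homOfLE hAZ).op f with hf'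
    set q' : Γ(X, A) := X.presheaf.map (homOfLE hAO).op q with hq'
    have hBo : X.basicOpen h' ≤ X.basicOpen h := by
      rw [hh', Scheme.basicOpen_res]; exact inf_le_right
    have hloc := hA.isLocalization_basicOpen h'
    have hmem : algebraMap Γ(X, A) Γ(X, X.basicOpen h') f' ∈
        Ideal.span {algebraMap Γ(X, A) Γ(X, X.basicOpen h') q'} := by
      rw [(hA.basicOpen h').mem_ideal_iff]
      intro y hy
      have hyA : y ∈ A := X.basicOpen_le h' hy
      have h1 := hf y (hBo hy)
      rw [hq y (hAO hyA)] at h1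
      rw [Ideal.map_span, Set.image_singleton]
      simp only [hf', hq', RingHom.algebraMap_toAlgebra]
      simpa only [TopCat.Presheaf.germ_res_apply] using h1
    have hmem2 : algebraMap Γ(X, A) Γ(X, X.basicOpen h') f' ∈
        (Ideal.span {q'}).map (algebraMap Γ(X, A) Γ(X, X.basicOpen h')) := by
      rwa [Ideal.map_span, Set.image_singleton]
    rw [IsLocalization.algebraMap_mem_map_algebraMap_iff (Submonoid.powers h')] at hmem2
    obtain ⟨_, ⟨m, rfl⟩, hm⟩ := hmem2
    refine ⟨(A : Set X), mem_nhdsWithin_of_mem_nhds (A.2.mem_nhds hzA), m, fun y hy hyZ ↦ ?_⟩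
    have hyA : y ∈ A := hy
    rw [hq y (hAO hyA)]
    have := Ideal.mem_map_of_mem (X.presheaf.germ A y hyA).hom hm
    rw [Ideal.map_span, Set.image_singleton] at this
    simp only [hh', hf', hq', ← map_pow, ← map_mul] at this
    simpa only [TopCat.Presheaf.germ_res_apply] using this

/-- The ideal sheaf with prescribed stalks `I x`, provided that the ideals `I x` are locally
generated by one regular function: its sections are the functions whose germs all lie in the
ideals `I x`. -/
def idealSheafOfStalks {X : Scheme.{0}} (I : ∀ x : X, Ideal (X.presheaf.stalk x))
    (hI : ∀ x : X, ∃ (O : X.Opens) (_ : x ∈ O) (q : Γ(X, O)),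
      ∀ (y : X) (hy : y ∈ O), I y = Ideal.span {X.presheaf.germ O y hy q}) :
    X.IdealSheafData where
  ideal Z := ⨅ z : Z.1, (I z.1).comap (X.presheaf.germ Z.1 z.1 z.2).hom
  map_ideal_basicOpen Z h := by
    apply le_antisymm
    · refine Ideal.map_le_iff_le_comap.mpr fun f hf ↦ Ideal.mem_comap.mpr ?_
      refine Ideal.mem_iInf.mpr ?_
      rintro ⟨z, hz⟩
      have h1 : X.presheaf.germ Z z (X.basicOpen_le h hz) f ∈ I z :=
        Ideal.mem_iInf.mp hf ⟨z, X.basicOpen_le h hz⟩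
      have h2 := TopCat.Presheaf.germ_res_apply X.presheaf (homOfLE (X.basicOpen_le h)) z hz f
      rw [← h2] at h1
      exact h1
    · intro F hF
      have hloc := Z.2.isLocalization_basicOpen h
      obtain ⟨⟨f, _, k, rfl⟩, hk⟩ := IsLocalization.surj (Submonoid.powers h) F
      have hF' : ∀ (y : X) (hy : y ∈ X.basicOpen h),
          X.presheaf.germ (X.basicOpen h) y hy F ∈ I y := by
        intro y hy
        have := (Ideal.mem_iInf.mp hF) ⟨y, hy⟩
        exact this
      obtain ⟨m, hm⟩ := exists_pow_mul_mem I hI Z h f (fun y hy ↦ by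
        have h1 := Ideal.mul_mem_left (I y)
          (X.presheaf.germ (X.basicOpen h) y hy (algebraMap Γ(X, Z) Γ(X, X.basicOpen h) (h ^ k)))
          (hF' y hy)
        rw [← map_mul, mul_comm, hk, RingHom.algebraMap_toAlgebra] at h1
        simpa only [TopCat.Presheaf.germ_res_apply] using h1)
      have h2 : h ^ m * f ∈ ⨅ z : Z.1, (I z.1).comap (X.presheaf.germ Z.1 z.1 z.2).hom := by
        rw [Ideal.mem_iInf]
        rintro ⟨z, hz⟩
        exact hm z hz
      have h3 := Ideal.mem_map_of_mem (algebraMap Γ(X, Z) Γ(X, X.basicOpen h)) h2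
      have hu : IsUnit (algebraMap Γ(X, Z) Γ(X, X.basicOpen h) (h ^ (m + k))) :=
        IsLocalization.map_units Γ(X, X.basicOpen h) (⟨h ^ (m + k), m + k, rfl⟩ : Submonoid.powers h)
      have h4 : algebraMap Γ(X, Z) Γ(X, X.basicOpen h) (h ^ m * f) =
          algebraMap Γ(X, Z) Γ(X, X.basicOpen h) (h ^ (m + k)) * F := by
        rw [map_mul, ← hk, pow_add, map_mul]
        ring
      rw [h4] at h3
      exact (Ideal.unit_mul_mem_iff_mem _ hu).mp h3

/-! ### The projective line over `ℂ` and the product `V × ℙ¹` -/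

/-- The standard grading of `ℂ[x₀, x₁]`. -/
abbrev grading : ℕ → Submodule ℂ (MvPolynomial (Fin 2) ℂ) :=
  MvPolynomial.homogeneousSubmodule (Fin 2) ℂ

instance : GradedAlgebra grading := MvPolynomial.gradedAlgebra

/-- The complex projective line `ℙ¹ = Proj ℂ[x₀, x₁]`. -/
abbrev P1 : Scheme.{0} := Proj grading

/-- The structure morphism `ℙ¹ ⟶ Spec ℂ`. -/
def P1.toSpec : P1 ⟶ Spec (.of ℂ) :=
  Proj.toSpecZero grading ≫ Spec.map (CommRingCat.ofHom (algebraMap ℂ (grading 0)))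

/-- The homogeneous coordinate `x_j` of `ℙ¹`. -/
abbrev coordX (j : Fin 2) : MvPolynomial (Fin 2) ℂ := MvPolynomial.X j

lemma coordX_mem (j : Fin 2) : coordX j ∈ grading 1 :=
  MvPolynomial.isHomogeneous_X ℂ j

/-- The standard chart `D₊(x_j) ⊆ ℙ¹`. -/
def P1.chart (j : Fin 2) : P1.Opens := Proj.basicOpen grading (coordX j)

/-- The regular function `x_i / x_j` on the chart `D₊(x_j)`. -/
def P1.ratio (i j : Fin 2) : Γ(P1, P1.chart j) :=
  (Proj.awayToSection grading (coordX j)).hom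
    (HomogeneousLocalization.Away.mk grading (coordX_mem j) 1 (coordX i)
      (by simpa using coordX_mem i))

lemma P1.exists_mem_chart (x : P1) : ∃ j, x ∈ P1.chart j := by
  have h : ⨆ j, Proj.basicOpen grading (coordX j) = ⊤ := by
    apply Proj.iSup_basicOpen_eq_top' grading coordX (fun j ↦ ⟨1, coordX_mem j⟩)
    rw [eq_top_iff]
    intro f _
    induction f using MvPolynomial.induction_on with
    | C a =>
      have : MvPolynomial.C a ∈ grading 0 := MvPolynomial.isHomogeneous_C _ _
      exact (Algebra.adjoin (grading 0) (Set.range coordX)).algebraMap_mem ⟨_, this⟩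
    | add p q hp hq => exact add_mem (hp trivial) (hq trivial)
    | mul_X p i hp => exact mul_mem (hp trivial) (Algebra.subset_adjoin ⟨i, rfl⟩)
  have hx : x ∈ ⨆ j, Proj.basicOpen grading (coordX j) := h ▸ trivial
  exact TopologicalSpace.Opens.mem_iSup.mp hx

lemma P1.ratio_mul_ratio (i j k : Fin 2) :
    P1.presheaf.map (homOfLE (inf_le_left : P1.chart j ⊓ P1.chart k ≤ _)).op (P1.ratio i j) *
      P1.presheaf.map (homOfLE (inf_le_right : P1.chart j ⊓ P1.chart k ≤ _)).op (P1.ratio j k) =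
    P1.presheaf.map (homOfLE (inf_le_right : P1.chart j ⊓ P1.chart k ≤ _)).op (P1.ratio i k) := by
  apply Subtype.ext
  funext x
  apply HomogeneousLocalization.val_injective
  have key : ∀ (a b : Fin 2) (hb : x.1 ∈ P1.chart b),
      ((P1.ratio a b).1 ⟨x.1, hb⟩).val =
        Localization.mk (coordX a) ⟨coordX b, hb⟩ := by
    intro a b hb
    refine (ProjectiveSpectrum.Proj.awayToSection_apply grading (coordX b) _ ⟨x.1, hb⟩).trans ?_
    rw [HomogeneousLocalization.Away.val_mk, Localization.mk_eq_mk', IsLocalization.map_mk',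
      Localization.mk_eq_mk']
    simp
  refine (HomogeneousLocalization.val_mul _ _).trans ?_
  erw [key i j x.2.1, key j k x.2.2, key i k x.2.2]
  rw [Localization.mk_mul, Localization.mk_eq_mk_iff, Localization.r_iff_exists]
  refine ⟨1, ?_⟩
  simp
  ring
/-- The product `V × ℙ¹` over `ℂ`. -/
abbrev prodP1 {V : Scheme.{0}} (s : V ⟶ Spec (.of ℂ)) : Scheme.{0} :=
  Limits.pullback s P1.toSpec

/-- The projection `V × ℙ¹ ⟶ V`. -/
abbrev prV {V : Scheme.{0}} (s : V ⟶ Spec (.of ℂ)) : prodP1 s ⟶ V := Limits.pullback.fst _ _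

/-- The projection `V × ℙ¹ ⟶ ℙ¹`. -/
abbrev prP {V : Scheme.{0}} (s : V ⟶ Spec (.of ℂ)) : prodP1 s ⟶ P1 := Limits.pullback.snd _ _

/-! ### Invertible sheaves and orders of vanishing -/

/-- A generator of the sheaf of modules `L` on an open set `U`: a section `e` of `L` over `U` such
that `f ↦ f • e` identifies `𝒪_V` with `L` over `U`. -/
structure LocalGenerator {V : Scheme.{0}} (L : V.Modules) where
  /-- the open set on which `L` is trivialized -/
  U : V.Opens
  /-- the generating section -/
  e : Γ(L, U)
  bijective : ∀ (U' : V.Opens) (h : U' ≤ U),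
    Function.Bijective (fun f : Γ(V, U') ↦ f • L.presheaf.map (homOfLE h).op e)

/-- `L` is an invertible sheaf: it is locally free of rank one. -/
def IsInvertibleSheaf {V : Scheme.{0}} (L : V.Modules) : Prop :=
  ∀ x : V, ∃ g : LocalGenerator L, x ∈ g.U

/-- The coordinate of a global section `a` with respect to a local generator `g`: the unique regular
function `f` on `g.U` with `a = f • g.e` over `g.U`. -/
def LocalGenerator.coord {V : Scheme.{0}} {L : V.Modules} (g : LocalGenerator L) (a : Γ(L, ⊤)) :
    Γ(V, g.U) :=
  (Equiv.ofBijective _ (g.bijective g.U le_rfl)).symm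
    (L.presheaf.map (homOfLE (le_top : g.U ≤ ⊤)).op a)

/-- The order of vanishing of a global section `a` of an invertible sheaf at a point `x`: the order
in the local ring at `x` of the coordinate of `a` with respect to a local generator. It does not
depend on the generator, the supremum is taken to avoid a choice. -/
def ordAt {V : Scheme.{0}} {L : V.Modules} (a : Γ(L, ⊤)) (x : V) : ℕ∞ :=
  ⨆ g : {g : LocalGenerator L // x ∈ g.U},
    Ring.ord (V.presheaf.stalk x) (V.presheaf.germ g.1.U x g.2 (g.1.coord a))

/-! ### The hypersurface `a₁ x₁ᵖ - a₀ x₀ᵖ = 0` in `V × ℙ¹` -/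

section Model

variable {V : Scheme.{0}} (s : V ⟶ Spec (.of ℂ)) {L : V.Modules} (p : ℕ) (a₀ a₁ : Γ(L, ⊤))

/-- The open subset of `V × ℙ¹` over which `L` has the generator `g` and `x_j` is invertible. -/
abbrev eqDomain (g : LocalGenerator L) (j : Fin 2) : (prodP1 s).Opens :=
  prV s ⁻¹ᵁ g.U ⊓ prP s ⁻¹ᵁ P1.chart j

/-- The local equation of the hypersurface `a₁ x₁ᵖ - a₀ x₀ᵖ = 0`: with `a_i = α_i • e` over the
domain of the local generator `e`, this is the regular function
`α₁ (x₁ / x_j)ᵖ - α₀ (x₀ / x_j)ᵖ`. -/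
def localEq (g : LocalGenerator L) (j : Fin 2) : Γ(prodP1 s, eqDomain s g j) :=
  (prV s).appLE g.U (eqDomain s g j) inf_le_left (g.coord a₁) *
      ((prP s).appLE (P1.chart j) (eqDomain s g j) inf_le_right (P1.ratio 1 j)) ^ p -
    (prV s).appLE g.U (eqDomain s g j) inf_le_left (g.coord a₀) *
      ((prP s).appLE (P1.chart j) (eqDomain s g j) inf_le_right (P1.ratio 0 j)) ^ p

/-- The ideal generated by the local equations in the local ring of `V × ℙ¹` at `z`. -/
def eqIdeal (z : prodP1 s) : Ideal ((prodP1 s).presheaf.stalk z) :=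
  Ideal.span {f | ∃ (g : LocalGenerator L) (j : Fin 2) (hz : z ∈ eqDomain s g j),
    f = (prodP1 s).presheaf.germ (eqDomain s g j) z hz (localEq s p a₀ a₁ g j)}

lemma LocalGenerator.coord_smul (g : LocalGenerator L) (a : Γ(L, ⊤)) (U' : V.Opens)
    (h : U' ≤ g.U) :
    V.presheaf.map (homOfLE h).op (g.coord a) • L.presheaf.map (homOfLE h).op g.e =
      L.presheaf.map (homOfLE (le_top : U' ≤ ⊤)).op a := by
  have h1 : g.coord a • L.presheaf.map (homOfLE (le_refl g.U)).op g.e =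
      L.presheaf.map (homOfLE (le_top : g.U ≤ ⊤)).op a :=
    (Equiv.ofBijective _ (g.bijective g.U le_rfl)).apply_symm_apply _
  have h2 := congr(L.presheaf.map (homOfLE h).op $h1)
  rw [Scheme.Modules.map_smul] at h2
  simp only [← CategoryTheory.comp_apply, ← Functor.map_comp] at h2
  exact h2

lemma LocalGenerator.exists_coord_eq (g g' : LocalGenerator L) :
    ∃ u : Γ(V, g.U ⊓ g'.U), ∀ a : Γ(L, ⊤),
      V.presheaf.map (homOfLE (inf_le_right : g.U ⊓ g'.U ≤ _)).op (g'.coord a) =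
        u * V.presheaf.map (homOfLE (inf_le_left : g.U ⊓ g'.U ≤ _)).op (g.coord a) := by
  obtain ⟨u, hu⟩ := (g'.bijective (g.U ⊓ g'.U) inf_le_right).2
    (L.presheaf.map (homOfLE (inf_le_left : g.U ⊓ g'.U ≤ _)).op g.e)
  refine ⟨u, fun a ↦ (g'.bijective (g.U ⊓ g'.U) inf_le_right).1 ?_⟩
  have h1 := g.coord_smul a (g.U ⊓ g'.U) inf_le_left
  have h2 := g'.coord_smul a (g.U ⊓ g'.U) inf_le_right
  dsimp only at hu ⊢
  rw [h2, ← h1, ← hu, smul_smul, mul_comm]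

lemma germ_appLE {X Y : Scheme.{0}} (f : X ⟶ Y) (U : Y.Opens) (W : X.Opens) (h : W ≤ f ⁻¹ᵁ U)
    (z : X) (hz : z ∈ W) (t : Γ(Y, U)) :
    X.presheaf.germ W z hz (f.appLE U W h t) =
      f.stalkMap z (Y.presheaf.germ U (f z) (h hz) t) := by
  rw [Scheme.Hom.appLE, CategoryTheory.comp_apply, TopCat.Presheaf.germ_res_apply]
  exact (Scheme.Hom.germ_stalkMap_apply f U z (h hz) t).symm

lemma germ_coord_eq {g g' : LocalGenerator L} {u : Γ(V, g.U ⊓ g'.U)} {a : Γ(L, ⊤)}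
    (h : V.presheaf.map (homOfLE (inf_le_right : g.U ⊓ g'.U ≤ _)).op (g'.coord a) =
        u * V.presheaf.map (homOfLE (inf_le_left : g.U ⊓ g'.U ≤ _)).op (g.coord a))
    (v : V) (hv : v ∈ g.U) (hv' : v ∈ g'.U) :
    V.presheaf.germ g'.U v hv' (g'.coord a) =
      V.presheaf.germ (g.U ⊓ g'.U) v ⟨hv, hv'⟩ u * V.presheaf.germ g.U v hv (g.coord a) := by
  have hm : v ∈ g.U ⊓ g'.U := ⟨hv, hv'⟩
  have := congr(V.presheaf.germ (g.U ⊓ g'.U) v hm $h)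
  rw [map_mul, TopCat.Presheaf.germ_res_apply, TopCat.Presheaf.germ_res_apply] at this
  exact this

lemma germ_ratio_eq (i j k : Fin 2) (v : P1) (hv : v ∈ P1.chart j) (hv' : v ∈ P1.chart k) :
    P1.presheaf.germ (P1.chart k) v hv' (P1.ratio i k) =
      P1.presheaf.germ (P1.chart j) v hv (P1.ratio i j) *
        P1.presheaf.germ (P1.chart k) v hv' (P1.ratio j k) := by
  have hm : v ∈ P1.chart j ⊓ P1.chart k := ⟨hv, hv'⟩
  have := congr(P1.presheaf.germ (P1.chart j ⊓ P1.chart k) v hm $(P1.ratio_mul_ratio i j k))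
  rw [map_mul, TopCat.Presheaf.germ_res_apply, TopCat.Presheaf.germ_res_apply,
    TopCat.Presheaf.germ_res_apply] at this
  exact this.symm

lemma germ_localEq_mem (g g' : LocalGenerator L) (j k : Fin 2) (z : prodP1 s)
    (hz : z ∈ eqDomain s g j) (hz' : z ∈ eqDomain s g' k) :
    (prodP1 s).presheaf.germ (eqDomain s g' k) z hz' (localEq s p a₀ a₁ g' k) ∈
      Ideal.span {(prodP1 s).presheaf.germ (eqDomain s g j) z hz (localEq s p a₀ a₁ g j)} := by
  obtain ⟨u, hu⟩ := g.exists_coord_eq g'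
  have hV (a : Γ(L, ⊤)) := germ_coord_eq (hu a) (prV s z) hz.1 hz'.1
  have hP (i : Fin 2) := germ_ratio_eq i j k (prP s z) hz.2 hz'.2
  rw [Ideal.mem_span_singleton]
  simp only [localEq, map_sub, map_mul, map_pow, germ_appLE]
  refine ⟨(prV s).stalkMap z (V.presheaf.germ (g.U ⊓ g'.U) (prV s z) ⟨hz.1, hz'.1⟩ u) *
    ((prP s).stalkMap z (P1.presheaf.germ (P1.chart k) (prP s z) hz'.2 (P1.ratio j k))) ^ p, ?_⟩
  rw [hV, hV, hP 0, hP 1]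
  simp only [map_mul]
  ring

lemma eqIdeal_eq_span (g : LocalGenerator L) (j : Fin 2) (z : prodP1 s)
    (hz : z ∈ eqDomain s g j) :
    eqIdeal s p a₀ a₁ z =
      Ideal.span {(prodP1 s).presheaf.germ (eqDomain s g j) z hz (localEq s p a₀ a₁ g j)} := by
  apply le_antisymm
  · rw [eqIdeal, Ideal.span_le]
    rintro _ ⟨g', k, hz', rfl⟩
    exact germ_localEq_mem s p a₀ a₁ g g' j k z hz hz'
  · rw [Ideal.span_le, Set.singleton_subset_iff]
    exact Ideal.subset_span ⟨g, j, hz, rfl⟩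

/-- The ideal sheaf of the hypersurface `a₁ x₁ᵖ - a₀ x₀ᵖ = 0` in `V × ℙ¹`. -/
def modelIdeal (hL : IsInvertibleSheaf L) : (prodP1 s).IdealSheafData :=
  idealSheafOfStalks (eqIdeal s p a₀ a₁) fun z ↦ by
    obtain ⟨g, hg⟩ := hL (prV s z)
    obtain ⟨j, hj⟩ := P1.exists_mem_chart (prP s z)
    exact ⟨eqDomain s g j, ⟨hg, hj⟩, localEq s p a₀ a₁ g j,
      fun y hy ↦ eqIdeal_eq_span s p a₀ a₁ g j y hy⟩

/-- The hypersurface `X₀ = {a₁ x₁ᵖ - a₀ x₀ᵖ = 0} ⊂ V × ℙ¹`. -/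
def model (hL : IsInvertibleSheaf L) : Scheme.{0} := (modelIdeal s p a₀ a₁ hL).subscheme

/-- The projection `π : X₀ ⟶ V`. -/
def modelToBase (hL : IsInvertibleSheaf L) : model s p a₀ a₁ hL ⟶ V :=
  (modelIdeal s p a₀ a₁ hL).subschemeι ≫ prV s

end Model

/-! ### Cyclic covers and their branch loci -/

lemma genericPoint_specializes {Y U : Scheme.{0}} [IsIntegral Y] [IsIntegral U] (σ : Y ⟶ U)
    [IsDominant σ] : σ (genericPoint Y) ⤳ genericPoint U := by
  have h : IsGenericPoint (σ (genericPoint Y)) Set.univ := by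
    have := (genericPoint_spec Y).image σ.continuous
    rwa [Set.image_univ, σ.denseRange.closure_range] at this
  exact h.specializes trivial

/-- The homomorphism of function fields `ℂ(U) ⟶ ℂ(Y)` induced by a dominant morphism `Y ⟶ U`. -/
def functionFieldMap {Y U : Scheme.{0}} [IsIntegral Y] [IsIntegral U] (σ : Y ⟶ U)
    [IsDominant σ] : U.functionField ⟶ Y.functionField :=
  U.presheaf.stalkSpecializes (genericPoint_specializes σ) ≫ σ.stalkMap (genericPoint Y)

/-- A morphism of integral schemes is a cyclic cover of order `p` if it is finite and dominant (hence
surjective) and the field extension `ℂ(U) ⊂ ℂ(Y)` is a Galois extension the Galois group of which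
is cyclic of order `p`. -/
structure IsCyclicCover {Y U : Scheme.{0}} [IsIntegral Y] [IsIntegral U] (p : ℕ) (σ : Y ⟶ U) :
    Prop where
  isFinite : IsFinite σ
  isDominant : IsDominant σ
  isGalois : letI := (functionFieldMap σ).hom.toAlgebra
    IsGalois U.functionField Y.functionField
  isCyclic : letI := (functionFieldMap σ).hom.toAlgebra
    IsCyclic (Y.functionField ≃ₐ[U.functionField] Y.functionField)
  card_eq : letI := (functionFieldMap σ).hom.toAlgebra
    Nat.card (Y.functionField ≃ₐ[U.functionField] Y.functionField) = p

/-- The branch locus of `σ`: the set of the images of the points at which `σ` is ramified, that is,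
at which the homomorphism of local rings is not unramified. -/
def branchLocus {Y U : Scheme.{0}} (σ : Y ⟶ U) : Set U :=
  {u | ∃ y : Y, σ y = u ∧ ¬ (σ.stalkMap y).hom.FormallyUnramified}

/-! ### Varieties and prime divisors -/

/-- A scheme is normal if its local rings are integrally closed domains. -/
def IsNormalScheme (X : Scheme.{0}) : Prop :=
  ∀ x : X, IsDomain (X.presheaf.stalk x) ∧ IsIntegrallyClosed (X.presheaf.stalk x)

/-- A prime divisor on `V`, given by its generic point, a point of codimension one. -/
structure PrimeDivisor (V : Scheme.{0}) where
  /-- the generic point of the divisor -/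
  pt : V
  coheight_pt : Order.coheight pt = 1

/-- The prime divisor as a closed subset of `V`. -/
def PrimeDivisor.support {V : Scheme.{0}} (T : PrimeDivisor V) : Set V := closure {T.pt}

/-- The order `ord_T a` of vanishing along `T` of a section `a` of an invertible sheaf. -/
def PrimeDivisor.ord {V : Scheme.{0}} (T : PrimeDivisor V) {L : V.Modules} (a : Γ(L, ⊤)) : ℕ∞ :=
  ordAt a T.pt

/-- `μ(T) = max (ord_T a₀, ord_T a₁)`. -/
def mu {V : Scheme.{0}} {L : V.Modules} (a₀ a₁ : Γ(L, ⊤)) (T : PrimeDivisor V) : ℕ∞ :=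
  max (T.ord a₀) (T.ord a₁)

end CyclicCover

end

/-!
Write `A` for the local ring of `V` at the generic point `t` of `T`. It is a discrete valuation
ring, because `V` is normal and `t` has codimension one; `t` lies in `U`, whose complement has
codimension at least two. Let `ϖ` be a uniformizer of `A`, and `K ⊂ F` the extension of function
fields given by `σ`, of degree `p`.

The birational map between `Y` and the model `X₀` carries the generic point of `Y` to a preimmersion
`Spec F ⟶ X₀` over `Spec K ⟶ V`. Its second coordinate is a point of `ℙ¹`, that is, an element `y`
of `F` which is a `p`-th root of the ratio of the two local functions of `a₀` and `a₁`, or of its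
inverse. This `y` is not in `K`: otherwise the point of `V × ℙ¹` would be defined over `K`, and as
a preimmersion is surjective on residue fields, `F` would equal `K`
(`exists_root_of_isPreimmersion`). As one of `a₀`, `a₁` does not vanish along `T`, this gives, after
replacing `y` by its inverse if necessary, `y ^ p = u * ϖ ^ m` with `u` a unit of `A` and
`m = μ(T)`. Here `m` is finite because the only
`p`-th root of `0` is `0`, which lies in `K` (`exists_root_unit_mul_uniformizer_pow`).

Ramification over `t` can now be read off from `m`. Let `q` be a point of `Y` over `t`.
* If `σ` is unramified at `q`, then `ϖ` generates the maximal ideal of the local ring at `q`, and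
  comparing valuations in `y ^ p = u * ϖ ^ m` shows `p ∣ m` (`dvd_of_pow_eq_of_formallyUnramified`).
* If `m = p * k`, then `z = y / ϖ ^ k` is a `p`-th root of the unit `u`. The discriminant of the
  basis `1, z, …, z ^ (p - 1)` of `F` is a unit of `A`, as `p` is, so the integral closure of `A`
  in `F` is generated by `z`. As `d z = 0`, it has no differentials over `A`, and neither has its
  localization at `q`
  (`formallyUnramified_of_pow_eq_unit`).

Since the branch locus is closed in `U` (`isClosed_branchLocus`), `T` lies in its closure in `V` if
and only if `t` is a branch point. The fibre of `σ` over `t` is not empty, so this holds if and only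
if `p` does not divide `m`.
-/

noncomputable section

namespace CyclicCover

/-! ### Kummer extensions of discretely valued fields -/

section Algebra

open Polynomial

/-- If `y ^ p` is a unit of `R`, the discriminant of `1, y, …, y ^ (p - 1)` is a unit of `R`, so the
powers of `y` span the integral closure of `R`. -/
lemma mem_adjoin_of_isIntegral_of_pow_eq {R K L : Type*} [CommRing R] [Field K]
    [Field L] [Algebra R K] [Algebra R L] [Algebra K L] [IsScalarTower R K L]
    [IsDomain R] [IsIntegrallyClosed R] [IsFractionRing R K]
    [FiniteDimensional K L] [Algebra.IsSeparable K L] {p : ℕ} (hp : p.Prime)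
    (hpR : IsUnit (p : R)) (hdeg : Module.finrank K L = p) {y : L}
    (hyK : y ∉ (algebraMap K L).range) {u : R} (hu : IsUnit u) (hy : y ^ p = algebraMap R L u)
    {z : L} (hz : IsIntegral R z) : z ∈ Algebra.adjoin R {y} := by
  have hint : IsIntegral K y := Algebra.IsIntegral.isIntegral y
  have hyR : IsIntegral R y := .of_pow hp.pos (hy ▸ isIntegral_algebraMap)
  have hnat : (minpoly K y).natDegree = p := by
    have h1 : (minpoly K y).natDegree ∣ p := hdeg ▸ minpoly.degree_dvd hint
    refine ((Nat.dvd_prime hp).mp h1).resolve_left fun h ↦ hyK ?_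
    exact minpoly.natDegree_eq_one_iff.mp h
  have hmin : minpoly K y = X ^ p - C (algebraMap R K u) := by
    refine (eq_of_monic_of_dvd_of_natDegree_le (minpoly.monic hint)
      (monic_X_pow_sub_C _ hp.ne_zero) (minpoly.dvd K y ?_) ?_).symm
    · simp [hy, ← IsScalarTower.algebraMap_apply R K L]
    · rw [natDegree_X_pow_sub_C, hnat]
  have htop : IntermediateField.adjoin K {y} = ⊤ := by
    refine Field.primitive_element_iff_minpoly_natDegree_eq K y |>.mpr ?_
    rw [hnat, hdeg]
  have htop' : Algebra.adjoin K {y} = ⊤ := by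
    rw [← IntermediateField.adjoin_simple_toSubalgebra_of_isAlgebraic hint.isAlgebraic, htop]
    rfl
  let B : PowerBasis K L := PowerBasis.ofAdjoinEqTop hint htop'
  have hB : B.gen = y := PowerBasis.ofAdjoinEqTop_gen hint htop'
  obtain ⟨v, hv⟩ := hpR.exists_right_inv
  obtain ⟨w, hw⟩ := hu.exists_right_inv
  have hv' : (p : L) * algebraMap R L v = 1 := by
    have := congr(algebraMap R L $hv); simpa using this
  have hw' : algebraMap R L u * algebraMap R L w = 1 := by
    rw [← map_mul, hw, map_one]
  -- the different `p * y ^ (p - 1)` of `y` has the integral inverse `y / (p * u)`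
  have hinv : (aeval y (minpoly K y).derivative) * (algebraMap R L (v * w) * y) = 1 := by
    have hpow : y ^ (p - 1) * y = algebraMap R L u := by
      rw [← pow_succ, Nat.sub_add_cancel hp.one_le, hy]
    rw [hmin]
    simp only [derivative_sub, derivative_X_pow, derivative_C, sub_zero, map_mul, map_pow, aeval_X,
      map_natCast]
    calc _ = ((p : L) * algebraMap R L v) * ((y ^ (p - 1) * y) * algebraMap R L w) := by ring
      _ = 1 := by rw [hv', hpow, hw', one_mul]
  have hnorm : IsIntegral R (Algebra.norm K (algebraMap R L (v * w) * y)) :=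
    Algebra.isIntegral_norm K (isIntegral_algebraMap.mul hyR)
  obtain ⟨r, hr⟩ := IsIntegrallyClosed.isIntegral_iff.mp hnorm
  have hd : (algebraMap R K ((-1) ^ (B.dim * (B.dim - 1) / 2) * r)) *
      Algebra.discr K B.basis = 1 := by
    rw [Algebra.discr_powerBasis_eq_norm, hB, map_mul, hr, mul_mul_mul_comm, ← map_mul,
      mul_comm (algebraMap R L _ * y), hinv]
    simp only [map_pow, map_neg, map_one, mul_one]
    rw [B.finrank, ← mul_pow]
    simp
  have hmem := Algebra.discr_mul_isIntegral_mem_adjoin K (B := B) (hB ▸ hyR) hz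
  have := (Algebra.adjoin R {B.gen}).smul_mem hmem ((-1) ^ (B.dim * (B.dim - 1) / 2) * r)
  rwa [← IsScalarTower.algebraMap_smul K, smul_smul, hd, one_smul, hB] at this

/-- Adjoining a `p`-th root of a unit is unramified when `p` is invertible. The ring `S` is a
localization of the integral closure of `R`, which is the meaning of `hS`. -/
lemma formallyUnramified_of_pow_eq_unit {R S K L : Type*} [CommRing R] [CommRing S]
    [Field K] [Field L] [Algebra R S] [Algebra R K] [Algebra R L] [Algebra K L] [Algebra S L]
    [IsScalarTower R K L] [IsScalarTower R S L]
    [IsDomain R] [IsIntegrallyClosed R] [IsFractionRing R K]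
    [FiniteDimensional K L] [Algebra.IsSeparable K L] [IsDomain S] [IsIntegrallyClosed S]
    [IsFractionRing S L] {p : ℕ} (hp : p.Prime)
    (hpR : IsUnit (p : R)) (hdeg : Module.finrank K L = p) {y : L}
    (hyK : y ∉ (algebraMap K L).range) {u : R} (hu : IsUnit u) (hy : y ^ p = algebraMap R L u)
    (hS : ∀ s : S, ∃ c : S, IsUnit c ∧ IsIntegral R c ∧ IsIntegral R (c * s)) :
    Algebra.FormallyUnramified R S := by
  have hinj : Function.Injective (algebraMap S L) := IsFractionRing.injective S L
  obtain ⟨t, rfl⟩ : ∃ t, algebraMap S L t = y := by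
    refine IsIntegrallyClosed.exists_algebraMap_eq_of_isIntegral_pow (R := S) hp.pos ?_
    rw [hy, IsScalarTower.algebraMap_apply R S L]
    exact isIntegral_algebraMap
  have ht : t ^ p = algebraMap R S u := by
    apply hinj
    rw [map_pow, hy, IsScalarTower.algebraMap_apply R S L]
  let D := KaehlerDifferential.D R S
  have hDt : D t = 0 := by
    have h1 : D (t ^ p) = 0 := by rw [ht, Derivation.map_algebraMap]
    rw [Derivation.leibniz_pow, ← Nat.cast_smul_eq_nsmul S, smul_smul] at h1
    refine (IsUnit.smul_eq_zero ?_).mp h1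
    have h2 : IsUnit (t ^ p) := ht ▸ hu.map (algebraMap R S)
    have h3 := hpR.map (algebraMap R S)
    rw [map_natCast] at h3
    exact h3.mul (((isUnit_pow_iff hp.ne_zero).mp h2).pow _)
  have hDint : ∀ b : S, IsIntegral R b → D b = 0 := by
    intro b hb
    have hmem := mem_adjoin_of_isIntegral_of_pow_eq hp hpR hdeg hyK hu hy
      (hb.map (IsScalarTower.toAlgHom R S L))
    rw [Algebra.adjoin_singleton_eq_range_aeval] at hmem
    obtain ⟨f, hf⟩ := hmem
    have hb' : aeval t f = b := by
      apply hinj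
      rw [← aeval_algebraMap_apply]
      exact hf
    rw [← hb', Derivation.map_aeval, hDt, smul_zero]
  rw [Algebra.formallyUnramified_iff, ← Submodule.subsingleton_iff S,
    ← subsingleton_iff_bot_eq_top,
    ← KaehlerDifferential.span_range_derivation, eq_comm, Submodule.span_eq_bot]
  rintro _ ⟨s, rfl⟩
  obtain ⟨c, hcu, hc, hcs⟩ := hS s
  have h1 := hDint _ hcs
  rw [Derivation.leibniz, hDint c hc, smul_zero, add_zero] at h1
  exact (hcu.smul_eq_zero).mp h1

/-- In an unramified extension a uniformizer `ϖ` stays a prime element, so that a `p`-th power has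
order divisible by `p`. -/
lemma dvd_of_pow_eq_of_formallyUnramified {R S L : Type*} [CommRing R] [CommRing S] [Field L]
    [Algebra R S] [Algebra R L] [Algebra S L] [IsScalarTower R S L]
    [IsDomain R] [IsDiscreteValuationRing R] [IsLocalRing S]
    [IsDomain S] [IsIntegrallyClosed S] [IsFractionRing S L] [IsLocalHom (algebraMap R S)]
    [Algebra.EssFiniteType R S] [Algebra.FormallyUnramified R S]
    (hRS : Function.Injective (algebraMap R S)) {p : ℕ} (hp : p.Prime) {ϖ u : R}
    (hϖ : Irreducible ϖ) (hu : IsUnit u) {m : ℕ} {y : L}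
    (hy : y ^ p = algebraMap R L (u * ϖ ^ m)) : p ∣ m := by
  have hprime : Prime (algebraMap R S ϖ) := by
    have hne : algebraMap R S ϖ ≠ 0 := by
      rw [Ne, map_eq_zero_iff _ hRS]; exact hϖ.ne_zero
    rw [← Ideal.span_singleton_prime hne, ← Set.image_singleton, ← Ideal.map_span,
      ← (IsDiscreteValuationRing.irreducible_iff_uniformizer ϖ).mp hϖ,
      Algebra.FormallyUnramified.map_maximalIdeal]
    exact (IsLocalRing.maximalIdeal.isMaximal S).isPrime
  obtain ⟨t, rfl⟩ : ∃ t, algebraMap S L t = y := by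
    refine IsIntegrallyClosed.exists_algebraMap_eq_of_isIntegral_pow (R := S) hp.pos ?_
    rw [hy, IsScalarTower.algebraMap_apply R S L]
    exact isIntegral_algebraMap
  have ht : t ^ p = algebraMap R S u * algebraMap R S ϖ ^ m := by
    apply IsFractionRing.injective S L
    rw [map_pow, hy, IsScalarTower.algebraMap_apply R S L, map_mul, map_pow]
  have h1 : p * emultiplicity (algebraMap R S ϖ) t = m := by
    rw [← emultiplicity_pow hprime, ht, emultiplicity_mul hprime,
      emultiplicity_pow_self hprime.ne_zero hprime.not_isUnit]
    rw [emultiplicity_eq_zero.mpr, zero_add]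
    exact fun h ↦ hprime.not_isUnit (isUnit_of_dvd_unit h (hu.map _))
  have hfin : emultiplicity (algebraMap R S ϖ) t ≠ ⊤ := by
    intro h
    rw [h, ENat.mul_top (by exact_mod_cast hp.ne_zero)] at h1
    exact ENat.natCast_ne_top m h1.symm
  obtain ⟨k, hk⟩ := ENat.ne_top_iff_exists.mp hfin
  rw [← hk] at h1
  exact ⟨k, by exact_mod_cast h1.symm⟩

end Algebra

/-! ### Points of the projective line with values in a field -/

lemma P1.adjoin_coordX : Algebra.adjoin (grading 0) (Set.range coordX) = ⊤ := by
  rw [eq_top_iff]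
  intro f _
  induction f using MvPolynomial.induction_on with
  | C a =>
    exact (Algebra.adjoin (grading 0) (Set.range coordX)).algebraMap_mem
      ⟨_, MvPolynomial.isHomogeneous_C _ a⟩
  | add p q hp hq => exact add_mem (hp trivial) (hq trivial)
  | mul_X p i hp => exact mul_mem (hp trivial) (Algebra.subset_adjoin ⟨i, rfl⟩)

/-- The function `x_i / x_j` as an element of the coordinate ring of the chart `D₊(x_j)`. -/
def P1.awayRatio (i j : Fin 2) : HomogeneousLocalization.Away grading (coordX j) :=
  HomogeneousLocalization.Away.mk grading (coordX_mem j) 1 (coordX i) (by simpa using coordX_mem i)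

lemma P1.awayRatio_self (j : Fin 2) : P1.awayRatio j j = 1 := by
  apply HomogeneousLocalization.val_injective
  rw [P1.awayRatio, HomogeneousLocalization.Away.val_mk, HomogeneousLocalization.val_one]
  rw [← Localization.mk_one, Localization.mk_eq_mk_iff, Localization.r_iff_exists]
  exact ⟨1, by simp⟩

/-- The functions on the chart `D₊(x_j)` as sections of the structure sheaf of `ℙ¹`. -/
def P1.awayToChart (j : Fin 2) :
    CommRingCat.of (HomogeneousLocalization.Away grading (coordX j)) ⟶ Γ(P1, P1.chart j) :=
  Proj.awayToSection grading (coordX j)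

/-- The open immersion of the chart `D₊(x_j)`. -/
def P1.chartι (j : Fin 2) :
    Spec (.of (HomogeneousLocalization.Away grading (coordX j))) ⟶ P1 :=
  Proj.awayι grading (coordX j) (coordX_mem j) one_pos

lemma P1.isAffineOpen_chart (j : Fin 2) : IsAffineOpen (P1.chart j) :=
  Proj.isAffineOpen_basicOpen grading (coordX j) (coordX_mem j) one_pos

lemma P1.specMap_awayToChart_chartι (j : Fin 2) :
    Spec.map (P1.awayToChart j) ≫ P1.chartι j = (P1.isAffineOpen_chart j).fromSpec := by
  have h : Proj.basicOpenToSpec grading (coordX j) ≫ P1.chartι j =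
      (Proj.basicOpen grading (coordX j)).ι := by
    rw [← Proj.basicOpenIsoSpec_hom grading (coordX j) (coordX_mem j) one_pos, P1.chartι,
      Proj.awayι, Iso.hom_inv_id_assoc]
  rw [← cancel_epi (P1.isAffineOpen_chart j).isoSpec.hom, IsAffineOpen.isoSpec_hom_fromSpec]
  exact h

lemma P1.ratio_eq (i j : Fin 2) :
    P1.ratio i j = (P1.awayToChart j).hom (P1.awayRatio i j) := rfl

lemma P1.ratio_self (j : Fin 2) : P1.ratio j j = 1 := by
  rw [P1.ratio_eq, P1.awayRatio_self, map_one]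

/-- The structure map from `ℂ` to the coordinate ring of the chart `D₊(x_j)`. -/
def P1.awayConst (j : Fin 2) : ℂ →+* HomogeneousLocalization.Away grading (coordX j) :=
  (HomogeneousLocalization.fromZeroRingHom grading _).comp (algebraMap ℂ (grading 0))

/-- The coordinate ring of `D₊(x_j)` is generated over `ℂ` by the functions `x_i / x_j`. -/
lemma P1.map_away_mem {M : Type*} [CommRing M] (j : Fin 2)
    (ψ : HomogeneousLocalization.Away grading (coordX j) →+* M) (T : Subring M)
    (hconst : ∀ c, ψ (P1.awayConst j c) ∈ T) (hratio : ∀ i, ψ (P1.awayRatio i j) ∈ T)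
    (x : HomogeneousLocalization.Away grading (coordX j)) : ψ x ∈ T := by
  have htop := HomogeneousLocalization.Away.adjoin_mk_prod_pow_eq_top (𝒜 := grading)
    (coordX_mem j) (Fin 2) coordX P1.adjoin_coordX (fun _ ↦ 1) coordX_mem
  have hx : x ∈ (⊤ : Subalgebra (grading 0) (HomogeneousLocalization.Away grading (coordX j))) :=
    trivial
  rw [← htop] at hx
  induction hx using Algebra.adjoin_induction with
  | mem x hx =>
    obtain ⟨a, ai, hai, -, rfl⟩ := hx
    have : HomogeneousLocalization.Away.mk grading (coordX_mem j) a (∏ i, coordX i ^ ai i)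
        (hai ▸ SetLike.prod_pow_mem_graded _ _ _ _ fun i _ ↦ coordX_mem i) =
        ∏ i, P1.awayRatio i j ^ ai i := by
      simp only [smul_eq_mul, mul_one] at hai
      apply HomogeneousLocalization.val_injective
      rw [← HomogeneousLocalization.algebraMap_apply, ← HomogeneousLocalization.algebraMap_apply,
        map_prod]
      simp only [map_pow, HomogeneousLocalization.algebraMap_apply,
        P1.awayRatio, HomogeneousLocalization.Away.val_mk, Localization.mk_pow,
        Localization.mk_prod]
      congr 1
      apply Subtype.ext
      rw [SubmonoidClass.coe_finsetProd]
      simp only [SubmonoidClass.coe_pow, pow_one, Finset.prod_pow_eq_pow_sum, hai]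
    rw [this, map_prod]
    exact prod_mem fun i _ ↦ by rw [map_pow]; exact pow_mem (hratio i) _
  | algebraMap r =>
    obtain ⟨f, hf⟩ := r
    obtain ⟨c, rfl⟩ : ∃ c, f = MvPolynomial.C c :=
      ⟨_, MvPolynomial.totalDegree_eq_zero_iff_eq_C.mp (Nat.le_zero.mp (hf.totalDegree_le))⟩
    exact hconst c
  | add x y _ _ hx hy => rw [map_add]; exact add_mem hx hy
  | mul x y _ _ hx hy => rw [map_mul]; exact mul_mem hx hy

/-- A point of `ℙ¹` with values in `R` in the chart `D₊(x_j)` is given by the homomorphism of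
coordinate rings. -/
lemma P1.specMap_chartι_eq {R : CommRingCat.{0}} (w : Spec R ⟶ P1) (j : Fin 2)
    (hw : ⊤ ≤ w ⁻¹ᵁ P1.chart j) :
    Spec.map (P1.awayToChart j ≫ w.appLE (P1.chart j) ⊤ hw ≫
      (Scheme.ΓSpecIso R).hom) ≫
        P1.chartι j = w := by
  have h2 := IsAffineOpen.SpecMap_appLE_fromSpec w (P1.isAffineOpen_chart j)
    (isAffineOpen_top (Spec R)) hw
  rw [IsAffineOpen.fromSpec_top, Scheme.isoSpec_Spec_inv] at h2
  rw [Spec.map_comp, Category.assoc, P1.specMap_awayToChart_chartι, Spec.map_comp, Category.assoc,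
    h2, ← Spec.map_comp_assoc, Iso.inv_hom_id, Spec.map_id, Category.id_comp]

lemma P1.chartι_toSpec (j : Fin 2) :
    P1.chartι j ≫ P1.toSpec =
      Spec.map (CommRingCat.ofHom (P1.awayConst j)) := by
  rw [P1.toSpec, P1.chartι, Proj.awayι_toSpecZero_assoc, ← Spec.map_comp]
  rfl

/-- A point of `ℙ¹` with values in `L` the coordinates of which lie in `K` is a point with values
in `K`. -/
lemma P1.exists_factor {K L : CommRingCat.{0}} (φ : K ⟶ L) (hφ : Function.Injective φ)
    (c : Spec K ⟶ Spec (.of ℂ)) (w : Spec L ⟶ P1) (hc : w ≫ P1.toSpec = Spec.map φ ≫ c)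
    (j : Fin 2) (hw : ⊤ ≤ w ⁻¹ᵁ P1.chart j)
    (hratio : ∀ i, (Scheme.ΓSpecIso L).hom (w.appLE (P1.chart j) ⊤ hw (P1.ratio i j)) ∈
      φ.hom.range) :
    ∃ w' : Spec K ⟶ P1, Spec.map φ ≫ w' = w ∧ w' ≫ P1.toSpec = c := by
  have hw' := P1.specMap_chartι_eq w j hw
  set ψ := P1.awayToChart j ≫ w.appLE (P1.chart j) ⊤ hw ≫
      (Scheme.ΓSpecIso L).hom with hψ
  obtain ⟨γ, rfl⟩ := Spec.map_surjective c
  have hconst : CommRingCat.ofHom (P1.awayConst j) ≫ ψ = γ ≫ φ := by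
    apply Spec.map_injective
    have h := congr($hw' ≫ P1.toSpec)
    rw [Category.assoc, P1.chartι_toSpec, hc, ← Spec.map_comp, ← Spec.map_comp] at h
    exact h
  have hmem := P1.map_away_mem j ψ.hom φ.hom.range
    (fun a ↦ ⟨γ a, congr($hconst a).symm⟩) hratio
  let e : K ≃+* φ.hom.range := RingEquiv.ofBijective φ.hom.rangeRestrict
    ⟨fun a b h ↦ hφ congr(($h : L)), φ.hom.rangeRestrict_surjective⟩
  let ψ' : CommRingCat.of (HomogeneousLocalization.Away grading (coordX j)) ⟶ K :=
    CommRingCat.ofHom (e.symm.toRingHom.comp (ψ.hom.codRestrict φ.hom.range hmem))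
  have hψ' : ψ' ≫ φ = ψ := by
    ext x
    have : e (e.symm ⟨ψ.hom x, hmem x⟩) = ⟨ψ.hom x, hmem x⟩ := e.apply_symm_apply _
    exact congr(($this : L))
  refine ⟨Spec.map ψ' ≫ P1.chartι j, ?_, ?_⟩
  · rw [← Spec.map_comp_assoc, hψ', hw']
  · rw [Category.assoc, P1.chartι_toSpec, ← Spec.map_comp]
    congr 1
    ext a
    apply hφ
    have := congr($hconst a)
    rw [← hψ'] at this
    exact this

/-! ### Points of the hypersurface `X₀` with values in a field -/

/-- A function whose restrictions to affine open subsets lie in the ideal sheaf `I` vanishes at the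
points of the closed subscheme of `I` with values in a local ring: such a point factors through an
affine open subset. -/
lemma appLE_eq_zero_of_forall_mem_ideal {X : Scheme.{0}} (I : X.IdealSheafData)
    {A : CommRingCat.{0}} [IsLocalRing A] (h : Spec A ⟶ I.subscheme) (D : X.Opens)
    (hh : ⊤ ≤ (h ≫ I.subschemeι) ⁻¹ᵁ D) (q : Γ(X, D))
    (hq : ∀ (Z : X.affineOpens) (hZ : Z.1 ≤ D), X.presheaf.map (homOfLE hZ).op q ∈ I.ideal Z) :
    (h ≫ I.subschemeι).appLE D ⊤ hh q = 0 := by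
  obtain ⟨_, ⟨Z, hZ, rfl⟩, hzZ, hZD⟩ := X.isBasis_affineOpens.exists_subset_of_mem_open
    (hh (show IsLocalRing.closedPoint A ∈ (⊤ : (Spec A).Opens) from trivial)) D.2
  have hZD : Z ≤ D := hZD
  have hZtop : ⊤ ≤ h ⁻¹ᵁ I.subschemeι ⁻¹ᵁ Z :=
    (Scheme.preimage_eq_top_of_closedPoint_mem (h ≫ I.subschemeι) hzZ).ge
  have h1 : I.subschemeι.app Z (X.presheaf.map (homOfLE hZD).op q) = 0 := by
    rw [show I.subschemeι.app Z = _ from I.subschemeι_app ⟨Z, hZ⟩, CategoryTheory.comp_apply]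
    have h2 : (CommRingCat.ofHom (Ideal.Quotient.mk (I.ideal ⟨Z, hZ⟩)))
        (X.presheaf.map (homOfLE hZD).op q) = 0 :=
      Ideal.Quotient.eq_zero_iff_mem.mpr (hq ⟨Z, hZ⟩ hZD)
    rw [h2, map_zero]
  have h3 := congr(h.appLE (I.subschemeι ⁻¹ᵁ Z) ⊤ hZtop $h1)
  rw [map_zero, ← CategoryTheory.comp_apply, Scheme.Hom.app_eq_appLE,
    Scheme.Hom.appLE_comp_appLE, ← CategoryTheory.comp_apply, Scheme.Hom.map_appLE] at h3
  exact h3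

section Model

variable {V : Scheme.{0}} {s : V ⟶ Spec (.of ℂ)} {L : V.Modules} {p : ℕ} {a₀ a₁ : Γ(L, ⊤)}

lemma localEq_mem_modelIdeal (hL : IsInvertibleSheaf L) (g : LocalGenerator L) (j : Fin 2)
    (Z : (prodP1 s).affineOpens) (hZ : Z.1 ≤ eqDomain s g j) :
    (prodP1 s).presheaf.map (homOfLE hZ).op (localEq s p a₀ a₁ g j) ∈
      (modelIdeal s p a₀ a₁ hL).ideal Z := by
  refine Ideal.mem_iInf.mpr fun z ↦ Ideal.mem_comap.mpr ?_
  rw [eqIdeal_eq_span s p a₀ a₁ g j z.1 (hZ z.2)]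
  refine Ideal.mem_span_singleton.mpr (dvd_of_eq ?_)
  exact (TopCat.Presheaf.germ_res_apply (prodP1 s).presheaf (homOfLE hZ) z.1 z.2 _).symm

/-- The closed immersion of `X₀` into `V × ℙ¹`. -/
def modelι (hL : IsInvertibleSheaf L) : model s p a₀ a₁ hL ⟶ prodP1 s :=
  (modelIdeal s p a₀ a₁ hL).subschemeι

instance (hL : IsInvertibleSheaf L) : IsPreimmersion (modelι (s := s) (p := p) (a₀ := a₀)
    (a₁ := a₁) hL) :=
  inferInstanceAs (IsPreimmersion (modelIdeal s p a₀ a₁ hL).subschemeι)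

/-- The local equation of `X₀` vanishes at the points of `X₀`. -/
lemma appLE_localEq_eq_zero {A : CommRingCat.{0}} [IsLocalRing A] (hL : IsInvertibleSheaf L)
    (h : Spec A ⟶ model s p a₀ a₁ hL) (g : LocalGenerator L) (j : Fin 2)
    (hh : ⊤ ≤ (h ≫ modelι hL) ⁻¹ᵁ eqDomain s g j) :
    (h ≫ modelι hL).appLE (eqDomain s g j) ⊤ hh
      (localEq s p a₀ a₁ g j) = 0 :=
  appLE_eq_zero_of_forall_mem_ideal _ h _ hh _ fun Z hZ ↦ localEq_mem_modelIdeal hL g j Z hZ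

lemma surjective_of_surjectiveOnStalks {K M : Type*} [CommRing K] [CommRing M] (hK : IsField K)
    (hM : IsField M) (φ : K →+* M) (h : φ.SurjectiveOnStalks) : Function.Surjective φ := by
  have := hM.nontrivial
  intro y
  obtain ⟨a, b, c, hc, hb, e⟩ :=
    RingHom.surjectiveOnStalks_iff_forall_ideal.mp h ⊥ bot_ne_top y
  rw [Ideal.mem_bot] at hc hb
  obtain ⟨c', hc'⟩ := hM.mul_inv_cancel hc
  obtain ⟨b', hb'⟩ := hK.mul_inv_cancel (a := b) fun h0 ↦ hb (by rw [h0, map_zero])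
  have hb'' : φ b * φ b' = 1 := by rw [← map_mul, hb', map_one]
  refine ⟨a * b', ?_⟩
  rw [map_mul]
  calc φ a * φ b' = (c * c') * (φ a * φ b') := by rw [hc', one_mul]
    _ = c' * φ b' * (c * φ a) := by ring
    _ = (c * c') * (φ b * φ b') * y := by rw [← e]; ring
    _ = y := by rw [hc', hb'', one_mul, one_mul]

/-- If `X₀` has a point over `V` the residue field of which is the field extension `M` of `K`, then
`M` contains a `p`-th root of `α₀ / α₁` or of `α₁ / α₀` (where `α_i` is the coordinate of `a_i`) not
lying in `K`: otherwise the point of `V × ℙ¹` would be defined over `K`. -/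
lemma exists_root_of_isPreimmersion {K M : CommRingCat.{0}} [IsLocalRing M] (hK : IsField K)
    (hM : IsField M) (φ : K ⟶ M) (hinj : Function.Injective φ) (hφ : ¬ Function.Surjective φ)
    (x : Spec K ⟶ V) (hL : IsInvertibleSheaf L)
    (h : Spec M ⟶ model s p a₀ a₁ hL) [IsPreimmersion h]
    (hx : h ≫ modelToBase s p a₀ a₁ hL = Spec.map φ ≫ x)
    (g : LocalGenerator L) (hg : ⊤ ≤ x ⁻¹ᵁ g.U) {α₀ α₁ : K}
    (hα₀ : α₀ = (Scheme.ΓSpecIso K).hom (x.appLE g.U ⊤ hg (g.coord a₀)))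
    (hα₁ : α₁ = (Scheme.ΓSpecIso K).hom (x.appLE g.U ⊤ hg (g.coord a₁))) :
    ∃ y : M, y ∉ φ.hom.range ∧ (φ α₁ * y ^ p = φ α₀ ∨ φ α₀ * y ^ p = φ α₁) := by
  set z : Spec M ⟶ prodP1 s := h ≫ modelι hL with hz
  have hpre : IsPreimmersion z := by
    rw [hz]; infer_instance
  have hzV : z ≫ prV s = Spec.map φ ≫ x := by
    rw [← hx, hz, Category.assoc]; rfl
  set w := z ≫ prP s with hw
  obtain ⟨j, hj⟩ := P1.exists_mem_chart (w (IsLocalRing.closedPoint M))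
  have hwj : ⊤ ≤ w ⁻¹ᵁ P1.chart j := (Scheme.preimage_eq_top_of_closedPoint_mem w hj).ge
  have hVg : ⊤ ≤ (z ≫ prV s) ⁻¹ᵁ g.U := by
    rw [hzV]
    exact fun t _ ↦ hg (show (Spec.map φ t) ∈ (⊤ : (Spec K).Opens)
      from trivial)
  have hD : ⊤ ≤ z ⁻¹ᵁ eqDomain s g j := fun t ht ↦ ⟨hVg ht, hwj ht⟩
  set r : Fin 2 → M := fun i ↦ (Scheme.ΓSpecIso M).hom (w.appLE (P1.chart j) ⊤ hwj
    (P1.ratio i j)) with hr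
  have hcoord : ∀ a : Γ(L, ⊤), (Scheme.ΓSpecIso M).hom
      ((z ≫ prV s).appLE g.U ⊤ hVg (g.coord a)) =
      φ ((Scheme.ΓSpecIso K).hom (x.appLE g.U ⊤ hg (g.coord a))) := by
    intro a
    have h1 : (z ≫ prV s).appLE g.U ⊤ hVg = x.appLE g.U ⊤ hg ≫ (Spec.map φ).appTop := by
      have h2 : (Spec.map φ ≫ x).appLE g.U ⊤ (hzV ▸ hVg) =
          x.appLE g.U ⊤ hg ≫ (Spec.map φ).appTop := by
        have h3 : (⊤ : (Spec M).Opens) ≤ Spec.map φ ⁻¹ᵁ ⊤ := le_rfl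
        rw [show (Spec.map φ).appTop = (Spec.map φ).appLE ⊤ ⊤ h3 from
          Scheme.Hom.app_eq_appLE _, Scheme.Hom.appLE_comp_appLE]
      rw [← h2]
      congr 1
    rw [h1, CategoryTheory.comp_apply]
    have h3 := Scheme.ΓSpecIso_naturality φ
    exact congr($h3 (x.appLE g.U ⊤ hg (g.coord a)))
  have heq : φ α₁ * r 1 ^ p = φ α₀ * r 0 ^ p := by
    have h0 := appLE_localEq_eq_zero hL h g j hD
    have h1 := congr((Scheme.ΓSpecIso M).hom $h0)
    rw [localEq] at h1
    simp only [map_sub, map_mul, map_pow, map_zero, ← CategoryTheory.comp_apply,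
      Scheme.Hom.appLE_comp_appLE] at h1
    rw [sub_eq_zero] at h1
    rw [hα₀, hα₁, ← hcoord, ← hcoord]
    exact h1
  have hself : r j = 1 := by simp only [hr, P1.ratio_self, map_one]
  -- if the coordinates lay in `K`, the preimmersion `z` would factor through `Spec M ⟶ Spec K`
  have hnot : ¬ ∀ i, r i ∈ φ.hom.range := by
    intro hall
    obtain ⟨w', hw', hw's⟩ := P1.exists_factor φ hinj (x ≫ s) w (by
      rw [hw, Category.assoc, ← Limits.pullback.condition, ← Category.assoc, hzV, Category.assoc])
      j hwj hall
    have hfac : Spec.map φ ≫ Limits.pullback.lift x w' hw's.symm = z := by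
      apply Limits.pullback.hom_ext
      · rw [Category.assoc, Limits.pullback.lift_fst]; exact hzV.symm
      · rw [Category.assoc, Limits.pullback.lift_snd]; exact hw'
    have : SurjectiveOnStalks (Spec.map φ ≫
      Limits.pullback.lift x w' hw's.symm) := by rw [hfac]; infer_instance
    have := SurjectiveOnStalks.of_comp (Spec.map φ)
      (Limits.pullback.lift x w' hw's.symm)
    exact hφ (surjective_of_surjectiveOnStalks hK hM φ.hom (SurjectiveOnStalks.Spec_iff.mp this))
  have hone : (1 : M) ∈ φ.hom.range := one_mem _
  rcases Fin.exists_fin_two.mp ⟨j, rfl⟩ with rfl | rfl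
  · refine ⟨r 1, fun h1 ↦ hnot (Fin.forall_fin_two.mpr ⟨hself ▸ hone, h1⟩), Or.inl ?_⟩
    rw [heq, hself, one_pow, mul_one]
  · refine ⟨r 0, fun h1 ↦ hnot (Fin.forall_fin_two.mpr ⟨h1, hself ▸ hone⟩), Or.inr ?_⟩
    rw [← heq, hself, one_pow, mul_one]

end Model

/-! ### The branch locus of a finite morphism -/

lemma isOpen_formallyUnramified_stalkMap {Y B : Scheme.{0}} (σ : Y ⟶ B) [LocallyOfFiniteType σ] :
    IsOpen {y : Y | (σ.stalkMap y).hom.FormallyUnramified} := by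
  rw [isOpen_iff_forall_mem_open]
  intro y hy
  obtain ⟨_, ⟨W, hW, rfl⟩, hyW, -⟩ :=
    B.isBasis_affineOpens.exists_subset_of_mem_open (Set.mem_univ (σ y)) isOpen_univ
  obtain ⟨_, ⟨Z, hZ, rfl⟩, hyZ, hZW⟩ :=
    Y.isBasis_affineOpens.exists_subset_of_mem_open hyW (σ ⁻¹ᵁ W).2
  have hZW : Z ≤ σ ⁻¹ᵁ W := hZW
  let φ : Γ(B, W) →+* Γ(Y, Z) := (σ.appLE W Z hZW).hom
  let _ : Algebra Γ(B, W) Γ(Y, Z) := φ.toAlgebra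
  have hfin : Algebra.FiniteType Γ(B, W) Γ(Y, Z) := σ.finiteType_appLE hW hZ hZW
  -- unramifiedness at a point of `Z` can be read off from the homomorphism of coordinate rings
  have key : ∀ y' : Z, (σ.stalkMap y'.1).hom.FormallyUnramified ↔
      hZ.primeIdealOf y' ∈ Algebra.unramifiedLocus Γ(B, W) Γ(Y, Z) := by
    intro y'
    have hloc := hZ.isLocalization_stalk y'
    have hlocB := hW.isLocalization_stalk ⟨σ y'.1, hZW y'.2⟩
    let ψ : Γ(B, W) →+* Y.presheaf.stalk y'.1 := (Y.presheaf.germ Z y'.1 y'.2).hom.comp φ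
    let _ : Algebra Γ(B, W) (Y.presheaf.stalk y'.1) := ψ.toAlgebra
    have : IsScalarTower Γ(B, W) Γ(Y, Z) (Y.presheaf.stalk y'.1) := .of_algebraMap_eq' rfl
    have hψ : ψ = (σ.stalkMap y'.1).hom.comp (B.presheaf.germ W (σ y'.1) (hZW y'.2)).hom := by
      ext f
      exact germ_appLE σ W Z hZW y'.1 y'.2 f
    have hgerm : (B.presheaf.germ W (σ y'.1) (hZW y'.2)).hom.FormallyUnramified := by
      let _ := B.presheaf.algebra_section_stalk ⟨σ y'.1, hZW y'.2⟩
      have h := Algebra.FormallyUnramified.of_isLocalization (R := Γ(B, W))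
        (Rₘ := B.presheaf.stalk (σ y'.1)) (hW.primeIdealOf ⟨σ y'.1, hZW y'.2⟩).asIdeal.primeCompl
      exact RingHom.formallyUnramified_algebraMap.mpr h
    let e := IsLocalization.algEquiv (hZ.primeIdealOf y').asIdeal.primeCompl
      (Y.presheaf.stalk y'.1) (Localization.AtPrime (hZ.primeIdealOf y').asIdeal)
    have hlocus : hZ.primeIdealOf y' ∈ Algebra.unramifiedLocus Γ(B, W) Γ(Y, Z) ↔
        ψ.FormallyUnramified := by
      change Algebra.FormallyUnramified _ _ ↔ Algebra.FormallyUnramified _ _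
      exact ⟨fun h ↦ .of_equiv (e.restrictScalars Γ(B, W)).symm,
        fun h ↦ .of_equiv (e.restrictScalars Γ(B, W))⟩
    rw [hlocus, hψ]
    exact ⟨fun h ↦ hgerm.comp h, fun h ↦ h.of_comp⟩
  have hopen : IsOpen {y' : Z | hZ.primeIdealOf y' ∈
      Algebra.unramifiedLocus Γ(B, W) Γ(Y, Z)} :=
    Algebra.isOpen_unramifiedLocus.preimage hZ.isoSpec.hom.continuous
  refine ⟨Subtype.val '' {y' : Z | hZ.primeIdealOf y' ∈
      Algebra.unramifiedLocus Γ(B, W) Γ(Y, Z)}, ?_, ?_, ⟨⟨y, hyZ⟩, (key ⟨y, hyZ⟩).mp hy, rfl⟩⟩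
  · rintro _ ⟨y', hy', rfl⟩
    exact (key y').mpr hy'
  · exact Z.2.isOpenMap_subtype_val _ hopen

lemma isClosed_branchLocus {Y B : Scheme.{0}} (σ : Y ⟶ B) [IsFinite σ] :
    IsClosed (branchLocus σ) := by
  have h : branchLocus σ = σ '' {y : Y | (σ.stalkMap y).hom.FormallyUnramified}ᶜ := by
    ext u
    exact ⟨fun ⟨y, hy, hn⟩ ↦ ⟨y, hn, hy⟩, fun ⟨y, hn, hy⟩ ↦ ⟨y, hy, hn⟩⟩
  rw [h]
  exact σ.isClosedMap _ (isOpen_formallyUnramified_stalkMap σ).isClosed_compl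

/-- A local ring of a finite scheme over `B` is a localization of a ring that is integral over the
local ring of `B`. -/
lemma exists_isIntegralElem_stalkMap {Y B : Scheme.{0}} (σ : Y ⟶ B) [IsFinite σ] (y : Y)
    (f : Y.presheaf.stalk y) :
    ∃ c : Y.presheaf.stalk y, IsUnit c ∧ (σ.stalkMap y).hom.IsIntegralElem c ∧
      (σ.stalkMap y).hom.IsIntegralElem (c * f) := by
  obtain ⟨_, ⟨W, hW, rfl⟩, hyW, -⟩ :=
    B.isBasis_affineOpens.exists_subset_of_mem_open (Set.mem_univ (σ y)) isOpen_univ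
  have hyW' : y ∈ σ ⁻¹ᵁ W := hyW
  have hZ : IsAffineOpen (σ ⁻¹ᵁ W) := hW.preimage σ
  have hloc := hZ.isLocalization_stalk ⟨y, hyW'⟩
  have hint : ∀ b : Γ(Y, σ ⁻¹ᵁ W),
      (σ.stalkMap y).hom.IsIntegralElem (Y.presheaf.germ (σ ⁻¹ᵁ W) y hyW' b) := by
    intro b
    obtain ⟨q, hq, hb⟩ := (σ.finite_app W hW).to_isIntegral b
    refine ⟨q.map (B.presheaf.germ W (σ y) hyW).hom, hq.map _, ?_⟩
    have hcomp : (σ.stalkMap y).hom.comp (B.presheaf.germ W (σ y) hyW).hom =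
        (Y.presheaf.germ (σ ⁻¹ᵁ W) y hyW').hom.comp (σ.app W).hom := by
      ext a
      exact σ.germ_stalkMap_apply W y hyW a
    rw [Polynomial.eval₂_map, hcomp]
    have := congr((Y.presheaf.germ (σ ⁻¹ᵁ W) y hyW').hom $hb)
    rwa [Polynomial.hom_eval₂, map_zero] at this
  let _ := Y.presheaf.algebra_section_stalk ⟨y, hyW'⟩
  obtain ⟨⟨b, c⟩, hbc⟩ := IsLocalization.surj
    (hZ.primeIdealOf ⟨y, hyW'⟩).asIdeal.primeCompl f
  refine ⟨Y.presheaf.germ (σ ⁻¹ᵁ W) y hyW' c.1, ?_, hint _, ?_⟩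
  · exact IsLocalization.map_units (Y.presheaf.stalk y) c
  · have : Y.presheaf.germ (σ ⁻¹ᵁ W) y hyW' c.1 * f = Y.presheaf.germ (σ ⁻¹ᵁ W) y hyW' b := by
      rw [mul_comm]; exact hbc
    rw [this]
    exact hint b

/-- A cyclic cover of prime order `p` generated by a `p`-th root of a unit times `ϖ ^ m` is
unramified at a point over the divisor `ϖ = 0` if and only if `p` divides `m`. -/
lemma formallyUnramified_stalkMap_iff {p : ℕ} (hp : p.Prime) {Y B : Scheme.{0}} [IsIntegral Y]
    [IsIntegral B] (hY : IsNormalScheme Y) (σ : Y ⟶ B) (hσ : IsCyclicCover p σ) (q : Y)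
    [IsDiscreteValuationRing (B.presheaf.stalk (σ q))]
    (hpR : IsUnit (p : B.presheaf.stalk (σ q))) {ϖ u : B.presheaf.stalk (σ q)}
    (hϖ : Irreducible ϖ) (hu : IsUnit u) {m : ℕ} {y : Y.functionField}
    (hyK : haveI := hσ.isDominant; y ∉ (functionFieldMap σ).hom.range)
    (hy : haveI := hσ.isDominant; y ^ p = functionFieldMap σ
      (algebraMap (B.presheaf.stalk (σ q)) B.functionField (u * ϖ ^ m))) :
    (σ.stalkMap q).hom.FormallyUnramified ↔ p ∣ m := by
  have := hσ.isDominant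
  have := hσ.isFinite
  obtain ⟨_, _⟩ := hY q
  algebraize [(σ.stalkMap q).hom, (functionFieldMap σ).hom]
  let _ : Algebra (B.presheaf.stalk (σ q)) Y.functionField :=
    ((algebraMap B.functionField Y.functionField).comp
      (algebraMap (B.presheaf.stalk (σ q)) B.functionField)).toAlgebra
  have hRKL : IsScalarTower (B.presheaf.stalk (σ q)) B.functionField Y.functionField :=
    .of_algebraMap_eq' rfl
  have hRSL : IsScalarTower (B.presheaf.stalk (σ q)) (Y.presheaf.stalk q) Y.functionField := by
    refine .of_algebraMap_eq fun r ↦ ?_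
    have h1 := Scheme.Hom.stalkSpecializes_stalkMap_apply σ (genericPoint Y) q
      ((genericPoint_spec Y).specializes trivial) r
    refine Eq.trans ?_ h1
    have h2 := TopCat.Presheaf.stalkSpecializes_comp_apply B.presheaf
      (genericPoint_specializes σ) ((genericPoint_spec B).specializes trivial : _ ⤳ σ q) r
    exact congr(σ.stalkMap (genericPoint Y) $h2)
  have : IsGalois B.functionField Y.functionField := hσ.isGalois
  have hdeg : Module.finrank B.functionField Y.functionField = p :=
    (IsGaloisGroup.card_eq_finrank (Y.functionField ≃ₐ[B.functionField] Y.functionField)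
      B.functionField Y.functionField).symm.trans hσ.card_eq
  have : FiniteDimensional B.functionField Y.functionField :=
    Module.finite_of_finrank_pos (hdeg ▸ hp.pos)
  change Algebra.FormallyUnramified _ _ ↔ _
  constructor
  · intro h
    have : Algebra.EssFiniteType (B.presheaf.stalk (σ q)) (Y.presheaf.stalk q) :=
      LocallyOfFiniteType.stalkMap σ q
    have : IsLocalHom (algebraMap (B.presheaf.stalk (σ q)) (Y.presheaf.stalk q)) :=
      inferInstanceAs (IsLocalHom (σ.stalkMap q).hom)
    have hinj : Function.Injective (algebraMap (B.presheaf.stalk (σ q)) (Y.presheaf.stalk q)) := by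
      refine Function.Injective.of_comp (f := algebraMap (Y.presheaf.stalk q) Y.functionField) ?_
      rw [← RingHom.coe_comp, ← IsScalarTower.algebraMap_eq,
        IsScalarTower.algebraMap_eq (B.presheaf.stalk (σ q)) B.functionField, RingHom.coe_comp]
      exact (algebraMap B.functionField Y.functionField).injective.comp
        (IsFractionRing.injective _ _)
    exact dvd_of_pow_eq_of_formallyUnramified (L := Y.functionField) hinj hp hϖ hu hy
  · rintro ⟨k, rfl⟩
    set t : B.functionField := algebraMap (B.presheaf.stalk (σ q)) B.functionField (ϖ ^ k) with ht
    have ht0 : t ≠ 0 := by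
      rw [ht, Ne, FaithfulSMul.algebraMap_eq_zero_iff]
      exact pow_ne_zero _ hϖ.ne_zero
    set t' : Y.functionField := algebraMap B.functionField Y.functionField t with ht'
    have ht0' : t' ≠ 0 := by rwa [ht', Ne, map_eq_zero]
    refine formallyUnramified_of_pow_eq_unit (K := B.functionField) (L := Y.functionField)
      (y := y * t'⁻¹) hp hpR hdeg ?_ hu ?_ (exists_isIntegralElem_stalkMap σ q)
    · intro h
      refine hyK ?_
      have := mul_mem h (show t' ∈ (algebraMap B.functionField Y.functionField).range
        from ⟨t, rfl⟩)
      rwa [inv_mul_cancel_right₀ ht0'] at this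
    · have h1 : y ^ p = algebraMap (B.presheaf.stalk (σ q)) Y.functionField u * t' ^ p := by
        refine hy.trans ?_
        rw [ht', ht, ← map_pow, ← map_pow, ← pow_mul, mul_comm k p, map_mul, map_mul]
        rfl
      rw [mul_pow, h1, inv_pow, mul_inv_cancel_right₀ (pow_ne_zero _ ht0')]

/-! ### Orders of vanishing -/

section Ord

variable {V : Scheme.{0}} {L : V.Modules}

lemma germ_coord_dvd (g g' : LocalGenerator L) (a : Γ(L, ⊤)) (x : V) (hx : x ∈ g.U)
    (hx' : x ∈ g'.U) :
    V.presheaf.germ g.U x hx (g.coord a) ∣ V.presheaf.germ g'.U x hx' (g'.coord a) := by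
  obtain ⟨u, hu⟩ := g.exists_coord_eq g'
  rw [germ_coord_eq (hu a) x hx hx']
  exact Dvd.intro_left _ rfl

/-- The order of vanishing may be computed with any local generator. -/
lemma ordAt_eq (g : LocalGenerator L) (a : Γ(L, ⊤)) (x : V) (hx : x ∈ g.U) :
    ordAt a x = Ring.ord (V.presheaf.stalk x) (V.presheaf.germ g.U x hx (g.coord a)) := by
  refine le_antisymm (iSup_le fun g' ↦ Ring.ord_le_ord_of_dvd (germ_coord_dvd g'.1 g a x g'.2 hx))
    (le_iSup_of_le ⟨g, hx⟩ le_rfl)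

end Ord

lemma ord_unit_mul_uniformizer_pow {A : Type*} [CommRing A] [IsDomain A]
    [IsDiscreteValuationRing A] {ϖ u : A} (hϖ : Irreducible ϖ) (hu : IsUnit u) (n : ℕ) :
    Ring.ord A (u * ϖ ^ n) = n := by
  have h1 : Ring.ord A ϖ = 1 := by
    have hmax := (IsDiscreteValuationRing.irreducible_iff_uniformizer ϖ).mp hϖ
    rw [Ring.ord, Module.length_eq_one_iff, isSimpleModule_iff_isCoatom, ← Ideal.isMaximal_def,
      ← hmax]
    infer_instance
  rw [Ring.ord_mul_of_isUnit_left hu, Ring.ord_pow (mem_nonZeroDivisors_of_ne_zero hϖ.ne_zero), h1,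
    nsmul_one]

lemma isUnit_of_ord_eq_zero {A : Type*} [CommRing A] {x : A} (h : Ring.ord A x = 0) :
    IsUnit x := by
  rw [Ring.ord, Module.length_eq_zero_iff, Ideal.Quotient.subsingleton_iff,
    Ideal.span_singleton_eq_top] at h
  exact h

/-- If one of `x₀`, `x₁` is a unit and `y` is a `p`-th root of `x₀ / x₁` or its inverse, then up to
inversion `y` is a `p`-th root of a unit times `ϖ ^ m`, where `m` is the order of `x₀`. The order is
finite since the only `p`-th root of `0` is `0`, which lies in `K`. -/
lemma exists_root_unit_mul_uniformizer_pow {A M : Type*} [CommRing A] [IsDomain A]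
    [IsDiscreteValuationRing A] [Field M] (ψ : A →+* M) (hψ : Function.Injective ψ)
    {K : Subfield M} {p : ℕ} {ϖ : A}
    (hϖ : Irreducible ϖ) {x₀ x₁ : A} (hx₁ : Ring.ord A x₁ = 0) {y : M} (hy : y ∉ K)
    (hxy : ψ x₁ * y ^ p = ψ x₀ ∨ ψ x₀ * y ^ p = ψ x₁) :
    ∃ (m : ℕ) (u : A) (y' : M), Ring.ord A x₀ = m ∧ IsUnit u ∧ y' ∉ K ∧
      y' ^ p = ψ (u * ϖ ^ m) := by
  have hu₁ := isUnit_of_ord_eq_zero hx₁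
  have hψ₁ : ψ x₁ ≠ 0 := (hu₁.map ψ).ne_zero
  have hy0 : y ≠ 0 := fun h ↦ hy (h ▸ zero_mem K)
  have hx₀ : x₀ ≠ 0 := by
    rintro rfl
    rw [map_zero, zero_mul] at hxy
    exact hxy.elim (mul_ne_zero hψ₁ (pow_ne_zero p hy0)) fun h ↦ hψ₁ h.symm
  have hψ₀ : ψ x₀ ≠ 0 := by rwa [Ne, map_eq_zero_iff ψ hψ]
  obtain ⟨v, hv⟩ := hu₁.exists_right_inv
  have hψv : ψ x₁ * ψ v = 1 := by rw [← map_mul, hv, map_one]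
  obtain ⟨m, w, hw⟩ := IsDiscreteValuationRing.eq_unit_mul_pow_irreducible hx₀ hϖ
  obtain ⟨y', hy', hpow⟩ : ∃ y' : M, y' ∉ K ∧ ψ x₁ * y' ^ p = ψ x₀ := by
    rcases hxy with h | h
    · exact ⟨y, hy, h⟩
    · refine ⟨y⁻¹, fun h' ↦ hy (inv_inv y ▸ inv_mem h'), ?_⟩
      rw [← h, inv_pow, mul_inv_cancel_right₀ (pow_ne_zero p hy0)]
  refine ⟨m, v * w, y', ?_, (IsUnit.of_mul_eq_one _ (mul_comm v x₁ ▸ hv)).mul w.isUnit, hy', ?_⟩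
  · rw [hw, ord_unit_mul_uniformizer_pow hϖ w.isUnit]
  · rw [mul_assoc, ← hw, map_mul, ← hpow, ← mul_assoc, mul_comm (ψ v), hψv, one_mul]

/-! ### Transport along birational maps -/

/-- The generic point of an integral scheme is carried over by a birational map, as a point with
the same local ring. -/
lemma exists_isPreimmersion_of_birationalOver {V Y Z : Scheme.{0}} [IsIntegral Y] {f : Y ⟶ V}
    {g : Z ⟶ V} (hfg : Scheme.BirationalOver f g) :
    ∃ h : Spec Y.functionField ⟶ Z, IsPreimmersion h ∧
      h ≫ g = Y.fromSpecStalk (genericPoint Y) ≫ f := by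
  obtain ⟨F, hF⟩ := hfg
  have hmem : genericPoint Y ∈ F.source := by
    refine ((genericPoint_spec Y).mem_open_set_iff F.source.2).mpr ?_
    rw [Set.univ_inter]
    exact F.dense_source.nonempty
  let h₀ : Spec Y.functionField ⟶ F.source := F.source.fromSpecStalkOfMem (genericPoint Y) hmem
  have hι : h₀ ≫ F.source.ι = Y.fromSpecStalk (genericPoint Y) :=
    F.source.fromSpecStalkOfMem_ι (genericPoint Y) hmem
  have hpre : IsPreimmersion h₀ := by
    have : IsPreimmersion (h₀ ≫ F.source.ι) := by rw [hι]; infer_instance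
    exact IsPreimmersion.of_comp h₀ F.source.ι
  refine ⟨h₀ ≫ F.iso.hom ≫ F.target.ι, inferInstance, ?_⟩
  rw [Category.assoc, Category.assoc, hF, ← hι, Category.assoc]

lemma ΓSpecIso_hom_fromSpecStalk_appLE {X : Scheme.{0}} (x : X) (W : X.Opens) (hx : x ∈ W)
    (h : ⊤ ≤ (X.fromSpecStalk x) ⁻¹ᵁ W) (f : Γ(X, W)) :
    (Scheme.ΓSpecIso _).hom ((X.fromSpecStalk x).appLE W ⊤ h f) = X.presheaf.germ W x hx f := by
  have h1 : (X.fromSpecStalk x).appLE W ⊤ h ≫ (Scheme.ΓSpecIso _).hom =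
      X.presheaf.germ W x hx := by
    rw [Scheme.Hom.appLE, Scheme.fromSpecStalk_app hx]
    simp only [Category.assoc]
    rw [← Functor.map_comp_assoc, ← op_comp,
      show homOfLE h ≫ homOfLE le_top = 𝟙 (⊤ : (Spec (X.presheaf.stalk x)).Opens) from
        Subsingleton.elim _ _, op_id, CategoryTheory.Functor.map_id, Category.id_comp, Iso.inv_hom_id,
      Category.comp_id]
  exact congr($h1 f)

lemma isUnit_natCast_stalk {V : Scheme.{0}} (s : V ⟶ Spec (.of ℂ)) (x : V) {n : ℕ} (hn : n ≠ 0) :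
    IsUnit (n : V.presheaf.stalk x) := by
  let ρ : ℂ →+* V.presheaf.stalk x :=
    (V.presheaf.germ ⊤ x trivial).hom.comp
      (s.appTop.hom.comp (Scheme.ΓSpecIso (.of ℂ)).inv.hom)
  have h : IsUnit (n : ℂ) := IsUnit.mk0 _ (Nat.cast_ne_zero.mpr hn)
  simpa using h.map ρ

/-! ### Varieties and cyclic covers -/

lemma isDiscreteValuationRing_stalk {V : Scheme.{0}} [IsLocallyNoetherian V]
    (hV : IsNormalScheme V) (x : V) (hx : Order.coheight x = 1) [IsDomain (V.presheaf.stalk x)] :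
    IsDiscreteValuationRing (V.presheaf.stalk x) := by
  obtain ⟨_, _⟩ := hV x
  have hdim : ringKrullDim (V.presheaf.stalk x) = 1 := by
    rw [ringKrullDim_stalk_eq_coheight, hx]; rfl
  have hle : Ring.KrullDimLE 1 (V.presheaf.stalk x) := krullDimLE_of_coheight_le hx.le
  have hfield : ¬ IsField (V.presheaf.stalk x) := fun h ↦ by
    rw [ringKrullDim_eq_zero_of_isField h] at hdim
    exact zero_ne_one hdim
  have : Ring.DimensionLEOne (V.presheaf.stalk x) :=
    ⟨fun hI hI' ↦ Ring.krullDimLE_one_iff_of_noZeroDivisors.mp hle _ hI hI'⟩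
  have : IsDedekindDomain (V.presheaf.stalk x) := { }
  exact ((IsDiscreteValuationRing.TFAE (V.presheaf.stalk x) hfield).out 0 2).mpr this

lemma IsCyclicCover.not_surjective {Y B : Scheme.{0}} [IsIntegral Y] [IsIntegral B] {p : ℕ}
    (hp : p.Prime) {σ : Y ⟶ B} (hσ : IsCyclicCover p σ) :
    haveI := hσ.isDominant
    ¬ Function.Surjective (functionFieldMap σ) := by
  have := hσ.isDominant
  intro h
  have hcard := hσ.card_eq
  let _ := (functionFieldMap σ).hom.toAlgebra
  have hsub : Subsingleton (Y.functionField ≃ₐ[B.functionField] Y.functionField) := by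
    refine ⟨fun a b ↦ AlgEquiv.ext fun l ↦ ?_⟩
    obtain ⟨k, rfl⟩ := h l
    exact (a.commutes k).trans (b.commutes k).symm
  exact hp.one_lt.ne (hcard ▸ Nat.card_unique.symm)

lemma IsCyclicCover.surjective {Y B : Scheme.{0}} [IsIntegral Y] [IsIntegral B] {p : ℕ}
    {σ : Y ⟶ B} (hσ : IsCyclicCover p σ) : Function.Surjective σ := by
  have := hσ.isDominant
  have := hσ.isFinite
  rw [← Set.range_eq_univ, ← σ.isClosedMap.isClosed_range.closure_eq]
  exact σ.denseRange.closure_range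

lemma specMap_functionFieldMap_fromSpecStalk {Y B : Scheme.{0}} [IsIntegral Y] [IsIntegral B]
    (σ : Y ⟶ B) [IsDominant σ] :
    Spec.map (functionFieldMap σ) ≫ B.fromSpecStalk (genericPoint B) =
      Y.fromSpecStalk (genericPoint Y) ≫ σ := by
  rw [functionFieldMap, Spec.map_comp, Category.assoc,
    Scheme.SpecMap_stalkSpecializes_fromSpecStalk, Scheme.SpecMap_stalkMap_fromSpecStalk]

/-- The value at the generic point of an open subscheme `U` of a function on `V`, in terms of the
germ of this function at a point of `U`. -/
lemma appLE_fromSpecStalk_ι {V : Scheme.{0}} (U : V.Opens) [IsIntegral U.toScheme] (t : U.toScheme)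
    (W : V.Opens) (ht : U.ι t ∈ W)
    (h : ⊤ ≤ (U.toScheme.fromSpecStalk (genericPoint U.toScheme) ≫ U.ι) ⁻¹ᵁ W) (c : Γ(V, W)) :
    (Scheme.ΓSpecIso _).hom
        ((U.toScheme.fromSpecStalk (genericPoint U.toScheme) ≫ U.ι).appLE W ⊤ h c) =
      algebraMap (U.toScheme.presheaf.stalk t) U.toScheme.functionField
        (U.ι.stalkMap t (V.presheaf.germ W (U.ι t) ht c)) := by
  have hspec := (genericPoint_spec U.toScheme).specializes (Set.mem_univ t)
  have hη : genericPoint U.toScheme ∈ U.ι ⁻¹ᵁ W := hspec.mem_open (U.ι ⁻¹ᵁ W).2 ht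
  have h' : ⊤ ≤ U.toScheme.fromSpecStalk (genericPoint U.toScheme) ⁻¹ᵁ (U.ι ⁻¹ᵁ W) := h
  rw [Scheme.Hom.comp_appLE, CategoryTheory.comp_apply,
    ΓSpecIso_hom_fromSpecStalk_appLE _ _ hη h', Scheme.Hom.germ_stalkMap_apply]
  exact (TopCat.Presheaf.germ_stalkSpecializes_apply U.toScheme.presheaf ht hspec _).symm

end CyclicCover

end

open CyclicCover in
theorem proposition1 {p : ℕ} (hp : p.Prime)
    -- a normal complex variety `V`
    {V : Scheme.{0}} (s : V ⟶ Spec (.of ℂ)) [IsIntegral V] [IsSeparated s]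
    [LocallyOfFiniteType s] [QuasiCompact s] (hV : CyclicCover.IsNormalScheme V)
    -- an open subset `U` whose complement has codimension at least two
    (U : V.Opens) [Nonempty U] (hU : ∀ v : V, v ∉ U → 2 ≤ Order.coheight v)
    -- a cyclic cover `σ` of `U` of order `p` by a normal variety `Y`
    {Y : Scheme.{0}} [IsIntegral Y] (hY : CyclicCover.IsNormalScheme Y)
    (σ : Y ⟶ U.toScheme) (hσ : CyclicCover.IsCyclicCover p σ)
    -- a variety `X` over `V`, birational to `Y` over `V`
    {X : Scheme.{0}} [IsIntegral X] (τ : X ⟶ V) (hX : Scheme.BirationalOver (σ ≫ U.ι) τ)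
    -- sections `a₀`, `a₁` of an invertible sheaf without a common divisor of zeros
    {L : V.Modules} (hL : CyclicCover.IsInvertibleSheaf L) (a₀ a₁ : Γ(L, ⊤))
    (hcoprime : ∀ T : CyclicCover.PrimeDivisor V, T.ord a₀ = 0 ∨ T.ord a₁ = 0)
    -- `X` is birational over `V` to the hypersurface `a₁ x₁ᵖ - a₀ x₀ᵖ = 0` in `V × ℙ¹`
    (hβ : Scheme.BirationalOver τ (CyclicCover.modelToBase s p a₀ a₁ hL))
    -- a prime divisor `T` on which `a₀` or `a₁` vanishes
    (T : CyclicCover.PrimeDivisor V) (hT : 0 < T.ord a₀ ∨ 0 < T.ord a₁) :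
    ∃ m : ℕ, CyclicCover.mu a₀ a₁ T = m ∧
      (T.support ⊆ closure (U.ι '' CyclicCover.branchLocus σ) ↔ ¬ p ∣ m) := by
  have hdom := hσ.isDominant
  have hfin := hσ.isFinite
  have hVN : IsLocallyNoetherian V := LocallyOfFiniteType.isLocallyNoetherian s
  obtain ⟨g, hg⟩ := hL T.pt
  obtain ⟨v, hv⟩ := T
  have hvU : v ∈ U := by
    by_contra h
    have := hU v h
    rw [hv] at this
    exact absurd this (by norm_num)
  obtain ⟨t, rfl⟩ : ∃ t : U.toScheme, U.ι t = v := ⟨⟨v, hvU⟩, rfl⟩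
  have hA := isDiscreteValuationRing_stalk hV (U.ι t) hv
  obtain ⟨ϖ, hϖ⟩ := IsDiscreteValuationRing.exists_irreducible (V.presheaf.stalk (U.ι t))
  -- the point of `X₀` given by the generic point of `Y`
  obtain ⟨h, hpre, hh⟩ := exists_isPreimmersion_of_birationalOver (hX.trans hβ)
  rw [← Category.assoc, ← specMap_functionFieldMap_fromSpecStalk σ, Category.assoc] at hh
  have hspec := (genericPoint_spec U.toScheme).specializes (Set.mem_univ t)
  have hgη : ⊤ ≤ (U.toScheme.fromSpecStalk (genericPoint U.toScheme) ≫ U.ι) ⁻¹ᵁ g.U := by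
    refine (Scheme.preimage_eq_top_of_closedPoint_mem _ ?_).ge
    refine Set.mem_of_eq_of_mem (congr_arg U.ι Scheme.fromSpecStalk_closedPoint) ?_
    exact hspec.mem_open (U.ι ⁻¹ᵁ g.U).2 hg
  obtain ⟨y, hyK, hy⟩ := exists_root_of_isPreimmersion (Field.toIsField U.toScheme.functionField)
    (Field.toIsField Y.functionField) (functionFieldMap σ) (functionFieldMap σ).hom.injective
    (hσ.not_surjective hp) _ hL h hh g hgη
    (appLE_fromSpecStalk_ι U t g.U hg hgη (g.coord a₀)).symm
    (appLE_fromSpecStalk_ι U t g.U hg hgη (g.coord a₁)).symm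
  let ψ : V.presheaf.stalk (U.ι t) →+* Y.functionField :=
    (functionFieldMap σ).hom.comp
      ((algebraMap (U.toScheme.presheaf.stalk t) U.toScheme.functionField).comp
        (U.ι.stalkMap t).hom)
  have hψ : Function.Injective ψ :=
    (functionFieldMap σ).hom.injective.comp ((IsFractionRing.injective _ _).comp
      (ConcreteCategory.bijective_of_isIso (U.ι.stalkMap t)).1)
  -- `hcoprime` puts the local functions of `a₀`, `a₁` at `t`, in one order or the other, in the form
  -- of a unit and `ϖ ^ μ(T)` times a unit
  obtain ⟨m, u, y', hm, hu, hyK', hy'⟩ : ∃ (m : ℕ) (u : V.presheaf.stalk (U.ι t))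
      (y' : Y.functionField), mu a₀ a₁ ⟨U.ι t, hv⟩ = m ∧ IsUnit u ∧
        y' ∉ (functionFieldMap σ).hom.fieldRange ∧ y' ^ p = ψ (u * ϖ ^ m) := by
    have h₀ : PrimeDivisor.ord ⟨U.ι t, hv⟩ a₀ = _ := ordAt_eq g a₀ (U.ι t) hg
    have h₁ : PrimeDivisor.ord ⟨U.ι t, hv⟩ a₁ = _ := ordAt_eq g a₁ (U.ι t) hg
    rcases hcoprime ⟨U.ι t, hv⟩ with h0 | h1
    · obtain ⟨m, u, y', hm, hr⟩ := exists_root_unit_mul_uniformizer_pow ψ hψ hϖ (h₀ ▸ h0)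
        (K := (functionFieldMap σ).hom.fieldRange) hyK hy.symm
      exact ⟨m, u, y', by rw [mu, h0, h₁, hm, max_eq_right zero_le], hr⟩
    · obtain ⟨m, u, y', hm, hr⟩ := exists_root_unit_mul_uniformizer_pow ψ hψ hϖ (h₁ ▸ h1)
        (K := (functionFieldMap σ).hom.fieldRange) hyK hy
      exact ⟨m, u, y', by rw [mu, h1, h₀, hm, max_eq_left zero_le], hr⟩
  refine ⟨m, hm, ?_⟩
  have hq : ∀ q : Y, σ q = t → ((σ.stalkMap q).hom.FormallyUnramified ↔ p ∣ m) := by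
    rintro q rfl
    let e := (asIso (U.ι.stalkMap (σ q))).commRingCatIsoToRingEquiv
    have : IsDiscreteValuationRing (U.toScheme.presheaf.stalk (σ q)) :=
      IsDiscreteValuationRing.RingEquivClass.isDiscreteValuationRing e
    refine formallyUnramified_stalkMap_iff hp hY σ hσ q
      (isUnit_natCast_stalk (U.ι ≫ s) (σ q) hp.ne_zero) (ϖ := e ϖ) (u := e u)
      ((MulEquiv.irreducible_iff e).mpr hϖ) (hu.map e) hyK' ?_
    rw [hy', ← map_pow, ← map_mul]
    rfl
  rw [PrimeDivisor.support, isClosed_closure.closure_subset_iff, Set.singleton_subset_iff]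
  have hcl : U.ι t ∈ closure (U.ι '' branchLocus σ) ↔ t ∈ branchLocus σ := by
    have h1 := U.ι.isEmbedding.isInducing.closure_eq_preimage_closure_image (branchLocus σ)
    rw [(isClosed_branchLocus σ).closure_eq] at h1
    exact (Set.ext_iff.mp h1 t).symm
  rw [hcl]
  constructor
  · rintro ⟨q, hqt, hram⟩
    rwa [hq q hqt] at hram
  · intro hpm
    obtain ⟨q, hqt⟩ := hσ.surjective t
    exact ⟨q, hqt, (hq q hqt).not.mpr hpm⟩
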